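/- **Setting.** At each stage $t=1,\dots,T$ an agent allocates a share $x^{(t)}\in[0,1]$ of a unit budget to a first resource and $1-x^{(t)}$ to a second one. The reward functions $f_1,f_2:[0,1]\to\mathbb R$ are unknown to the agent. The regret is $$R(T)=\max_{x\in[0,1]}\big(f_1(x)+f_2(1-x)\big)-\frac1T\sum_{t=1}^T\big(f_1(x^{(t)})+f_2(1-x^{(t)})\big).$$ After choosing $x^{(t)}$ the agent receives noisy gradient feedback, of one of the following two kinds: (a) the number $f_1'(x^{(t)})-f_2'(1-x^{(t)})+\varepsilon_t$, where the $\varepsilon_t$ are i.i.d. with law $\nu$; (b) the pair $\big(f_1'(x^{(t)})+\zeta_1^{(t)},\,f_2'(1-x^{(t)})+\zeta_2^{(t)}\big)$, where all $\zeta_k^{(t)}$ are i.i.d. with law $\nu$. An algorithm chooses $x^{(t)}$ as a measurable function of the previous observations and of a random seed that is independent of the noise; it may depend on $T$, $\beta$ and $\nu$. We say that $f_1,f_2$ satisfy pair-wisely the Łojasiewicz inequality with exponent $\beta$ and constant $C$ if for every $b\in[0,1]$ the function $\varphi_b(z)=f_1(z)+f_2(b-z)$ satisfies $\max_{[0,b]}\varphi_b-\varphi_b(z)\le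 C\,|\varphi_b'(z)|^{\beta}$ for all $z\in[0,b]$. **Theorem.** There is a centred noise law $\nu$ on $[-1,1]$ such that, for every $\beta\in[1,2]$, there are constants $c_\beta,C_\beta>0$ and $L_\beta,L'_\beta\ge 0$, depending only on $\beta$, for which the following holds. For every horizon $T\ge1$, for each of the two kinds of feedback and for every algorithm, there are two functions $f_1,f_2$ that are concave, non-decreasing, vanish at $0$, are differentiable, $L_\beta$-Lipschitz and $L'_\beta$-smooth (that is, have $L'_\beta$-Lipschitz derivative) on $[0,1]$, and satisfy pair-wisely the Łojasiewicz inequality with exponent $\beta$ and constant $C_\beta$, such that $$\mathbb E\,R(T)\ \ge\ c_\beta\,T^{-\beta/2}.$$ -/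

import Mathlib

open Set MeasureTheory
open scoped NNReal BigOperators

universe u

/-! Repeated allocation of one unit of budget between two resources: at every stage the share
`x ∈ [0, 1]` goes to the first resource and `1 - x` to the second. -/

/-- A reward function on `[0, 1]` with diminishing returns: concave, non-decreasing, zero at `0`,
differentiable (one-sidedly at the end points), `L`-Lipschitz and `L'`-smooth. -/
structure IsReward (L L' : ℝ≥0) (f : ℝ → ℝ) : Prop where
  concave : ConcaveOn ℝ (Icc 0 1) f
  monotone : MonotoneOn f (Icc 0 1)
  zero : f 0 = 0
  differentiable : DifferentiableOn ℝ f (Icc 0 1)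
  lipschitz : LipschitzOnWith L f (Icc 0 1)
  smooth : LipschitzOnWith L' (derivWithin f (Icc 0 1)) (Icc 0 1)

/-- The Łojasiewicz inequality for (concave) `φ` on the domain `s`, with exponent `β` and
constant `C`: for every `x ∈ s`, `max_s φ - φ x ≤ C * |φ' x| ^ β`. -/
def LojasiewiczOn (φ : ℝ → ℝ) (s : Set ℝ) (β C : ℝ) : Prop :=
  ∀ x ∈ s, ∀ y ∈ s, φ y - φ x ≤ C * |derivWithin φ s x| ^ β

/-- `f₁` and `f₂` satisfy pair-wisely the Łojasiewicz inequality: for every budget `b ∈ [0, 1]`,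
the function `z ↦ f₁ z + f₂ (b - z)` satisfies it on `[0, b]`. -/
def PairwiseLojasiewicz (f₁ f₂ : ℝ → ℝ) (β C : ℝ) : Prop :=
  ∀ b ∈ Icc (0 : ℝ) 1, LojasiewiczOn (fun z => f₁ z + f₂ (b - z)) (Icc 0 b) β C

/-- The regret after `T` stages of the allocations `x 0, …, x (T - 1)`: the optimal reward of one
stage minus the average reward over the `T` stages. -/
noncomputable def regret (f₁ f₂ : ℝ → ℝ) (T : ℕ) (x : ℕ → ℝ) : ℝ :=
  sSup ((fun z => f₁ z + f₂ (1 - z)) '' Icc 0 1)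
    - (1 / (T : ℝ)) * ∑ t ∈ Finset.range T, (f₁ (x t) + f₂ (1 - x t))

/-- A (randomized) allocation algorithm receiving feedback in `Y`: it draws an internal random seed
once, and at stage `t` it chooses the share of the first resource as a measurable function of the
seed and of the `t` observations made so far. -/
structure Algorithm (Y : Type) [MeasurableSpace Y] where
  Seed : Type u
  [seedSpace : MeasurableSpace Seed]
  seedLaw : Measure Seed
  [isProb : IsProbabilityMeasure seedLaw]
  alloc : (t : ℕ) → Seed → (Fin t → Y) → Icc (0 : ℝ) 1
  measurable_alloc : ∀ t, Measurable (fun p : Seed × (Fin t → Y) => alloc t p.1 p.2)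

attribute [instance] Algorithm.seedSpace Algorithm.isProb

namespace Algorithm

variable {Y N : Type} [MeasurableSpace Y] [MeasurableSpace N]

/-- The first `t` observations, where `obs x n` is the feedback when `x` is played and the noise
takes the value `n`, for the seed `s` and the noise sequence `ζ`. -/
def history (A : Algorithm.{u} Y) (obs : ℝ → N → Y) (s : A.Seed) (ζ : ℕ → N) :
    (t : ℕ) → (Fin t → Y)
  | 0 => fun i => i.elim0
  | t + 1 =>
      let h := A.history obs s ζ t
      Fin.snoc (α := fun _ => Y) h (obs (A.alloc t s h) (ζ t))

/-- The share allocated to the first resource at stage `t`. -/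
def play (A : Algorithm.{u} Y) (obs : ℝ → N → Y) (s : A.Seed) (ζ : ℕ → N) (t : ℕ) : ℝ :=
  A.alloc t s (A.history obs s ζ t)

/-- The expected regret, over the seed and over an independent i.i.d. noise sequence of law `ν`. -/
noncomputable def expectedRegret (A : Algorithm.{u} Y) (obs : ℝ → N → Y) (ν : Measure N)
    [IsProbabilityMeasure ν] (f₁ f₂ : ℝ → ℝ) (T : ℕ) : ℝ :=
  ∫ p, regret f₁ f₂ T (A.play obs p.1 p.2) ∂(A.seedLaw.prod (Measure.infinitePi fun _ : ℕ => ν))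

end Algorithm

/-- Noisy observation of the derivative of `x ↦ f₁ x + f₂ (1 - x)`. -/
noncomputable def slopeFeedback (f₁ f₂ : ℝ → ℝ) (x : ℝ) (n : ℝ) : ℝ :=
  (derivWithin f₁ (Icc 0 1) x - derivWithin f₂ (Icc 0 1) (1 - x)) + n

/-- Separate noisy observations of the derivatives of both reward functions. -/
noncomputable def gradientFeedback (f₁ f₂ : ℝ → ℝ) (x : ℝ) (n : ℝ × ℝ) : ℝ × ℝ :=
  (derivWithin f₁ (Icc 0 1) x + n.1, derivWithin f₂ (Icc 0 1) (1 - x) + n.2)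

/-!
The lower bound is a two-point argument. The second reward is `f₂ x = 2 x`, and the first one is
`f₁ x = 2 x + bend e k w x`, where the derivative `e - k x - max (x - w) 0` of `bend` is decreasing
and piecewise linear. For a small `δ`, put `k = δ ^ (2 - β)` and `w = δ ^ (β - 1)`, so that
`k w = δ`. The best share is `0` when `e = 0` and `w` when `e = δ`, and a share on the wrong side of
`w / 2` costs at least `k w² / 8 = δ ^ β / 8`. As `f₂` is linear, the payoff with budget `b` is
`bend e k w z + 2 b`, whatever `b` is; the pairwise Łojasiewicz inequality thus reduces to the
statement that the slope of `bend` controls the distance to its zero with exponent `β - 1`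
(`pairwiseLojasiewicz_bend`, `knot_sub_le`, `zero_sub_le`). The curvature `k` is just large enough
for this at distances up to `w`, and beyond `w` the curvature is at least `1`.

The feedbacks in the two environments differ by a shift of size `δ`. The noise has density
`15 / 16 (1 - x²)²` on `[-1, 1]`, whose square root is Lipschitz on the line, so the Hellinger
affinity of the two laws of one observation is at least `1 - 8 δ²` (`affinity_noiseRoot`). The seed
and the past observations form a Markov chain (`Algorithm.stateLaw_succ`) along which affinities
multiply (`HasAffinity.observe`); hence before every stage `t < T` the affinity of the two laws of
the state is at least `(1 - 8 δ²) ^ t ≥ 1 / 2` as soon as `16 δ² T ≤ 1`. Two laws with such an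
affinity cannot be tested against each other with total error below `1 / 8`
(`HasAffinity.le_measure_add_measure_compl`), so at every stage the expected losses in the two
environments add up to at least `δ ^ β / 64`. Taking `δ = T ^ (-1 / 2) / 4` gives the rate
`T ^ (-β / 2)`.
-/

/-! ### Hellinger affinity -/

/-- The Hellinger affinity `∫ √(dμ/dm · dμ'/dm) dm` of `μ` and `μ'` is at least `a`. The densities
with respect to a dominating measure `m` are given by their square roots `p` and `q`. -/
def HasAffinity {H : Type*} [MeasurableSpace H] (μ μ' : Measure H) (a : ENNReal) : Prop :=
  ∃ m : Measure H, SFinite m ∧ ∃ p q : H → ℝ≥0, Measurable p ∧ Measurable q ∧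
    μ = m.withDensity (fun h => (p h : ENNReal) ^ 2) ∧
    μ' = m.withDensity (fun h => (q h : ENNReal) ^ 2) ∧
    a ≤ ∫⁻ h, (p h : ENNReal) * q h ∂m

theorem hasAffinity_self {H : Type*} [MeasurableSpace H] (μ : Measure H) [IsProbabilityMeasure μ] :
    HasAffinity μ μ 1 :=
  ⟨μ, inferInstance, 1, 1, measurable_const, measurable_const, by simp, by simp, by simp⟩

theorem HasAffinity.mono {H : Type*} [MeasurableSpace H] {μ μ' : Measure H} {a a' : ENNReal}
    (h : HasAffinity μ μ' a) (ha : a' ≤ a) : HasAffinity μ μ' a' := by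
  obtain ⟨m, hm, p, q, hp, hq, hμ, hμ', hpq⟩ := h
  exact ⟨m, hm, p, q, hp, hq, hμ, hμ', ha.trans hpq⟩

/-- A test between two laws of affinity at least `1 / 2` has total error at least `1 / 8`. This is
the pointwise inequality `2 p q ≤ 4 p² + q² / 4` on `S`, and the symmetric one on `Sᶜ`,
integrated. -/
theorem HasAffinity.le_measure_add_measure_compl {H : Type*} [MeasurableSpace H]
    {μ μ' : Measure H} [IsProbabilityMeasure μ] [IsProbabilityMeasure μ']
    (h : HasAffinity μ μ' (1 / 2)) {S : Set H} (hS : MeasurableSet S) :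
    1 / 8 ≤ μ.real S + μ'.real Sᶜ := by
  obtain ⟨m, _, p, q, hp, hq, hμ, hμ', ha⟩ := h
  have hp2 : Measurable fun x => (p x : ENNReal) ^ 2 := by fun_prop
  have hq2 : Measurable fun x => (q x : ENNReal) ^ 2 := by fun_prop
  have hpt : ∀ x, 8 * ((p x : ENNReal) * q x) ≤
      (16 * S.indicator (fun x => (p x : ENNReal) ^ 2) x +
        16 * Sᶜ.indicator (fun x => (q x : ENNReal) ^ 2) x) +
        ((p x : ENNReal) ^ 2 + (q x : ENNReal) ^ 2) := by
    intro x
    by_cases hx : x ∈ S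
    · simp only [hx, indicator_of_mem, mem_compl_iff, not_true_eq_false, not_false_eq_true,
        indicator_of_notMem]
      norm_cast
      rw [← NNReal.coe_le_coe]
      push_cast
      nlinarith [sq_nonneg (4 * (p x : ℝ) - q x), sq_nonneg (p x : ℝ)]
    · simp only [hx, indicator_of_mem, mem_compl_iff, not_false_eq_true,
        indicator_of_notMem]
      norm_cast
      rw [← NNReal.coe_le_coe]
      push_cast
      nlinarith [sq_nonneg (4 * (q x : ℝ) - p x), sq_nonneg (q x : ℝ)]
  have hint := lintegral_mono (μ := m) hpt
  rw [lintegral_add_left (by measurability), lintegral_add_left (by measurability),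
    lintegral_const_mul _ (by fun_prop), lintegral_const_mul _ (by measurability),
    lintegral_const_mul _ (by measurability), lintegral_indicator hS, lintegral_indicator hS.compl,
    ← withDensity_apply _ hS, ← withDensity_apply _ hS.compl, lintegral_add_left hp2,
    ← hμ, ← hμ'] at hint
  have h1 : ∫⁻ x, (p x : ENNReal) ^ 2 ∂m = 1 := by
    rw [← setLIntegral_univ, ← withDensity_apply _ MeasurableSet.univ, ← hμ, measure_univ]
  have h2 : ∫⁻ x, (q x : ENNReal) ^ 2 ∂m = 1 := by
    rw [← setLIntegral_univ, ← withDensity_apply _ MeasurableSet.univ, ← hμ', measure_univ]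
  rw [h1, h2, ← ofReal_measureReal, ← ofReal_measureReal] at hint
  have h3 : (8 : ENNReal) * (1 / 2) ≤ _ := (mul_le_mul_right ha 8).trans hint
  have h4 : (8 : ENNReal) * (1 / 2) = ENNReal.ofReal 4 := by
    rw [← ENNReal.toReal_eq_toReal_iff' (by finiteness) (by finiteness)]; norm_num
  have h5 : (16 * ENNReal.ofReal (μ.real S) + 16 * ENNReal.ofReal (μ'.real Sᶜ) + (1 + 1)) =
      ENNReal.ofReal (16 * μ.real S + 16 * μ'.real Sᶜ + 2) := by
    rw [ENNReal.ofReal_add (by positivity) (by norm_num), ENNReal.ofReal_add (by positivity)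
      (by positivity), ENNReal.ofReal_mul (by norm_num), ENNReal.ofReal_mul (by norm_num)]
    norm_num
  rw [h4, h5, ENNReal.ofReal_le_ofReal_iff (by positivity)] at h3
  linarith

/-- Affinities multiply when each law is extended by an observation `g h + n` whose noise `n` has
density `w ^ 2`, provided that the noise laws centred at `g h` and at `g' h` always have affinity
at least `b`. The extended state is coded in `H'` by `e`, with left inverse `d`. -/
theorem HasAffinity.observe {H H' G : Type*} [MeasurableSpace H] [MeasurableSpace H']
    [MeasurableSpace G] [AddGroup G] [MeasurableAdd₂ G] [MeasurableNeg G] {l : Measure G}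
    [SFinite l] [l.IsAddLeftInvariant] {w : G → ℝ≥0} (hw : Measurable w)
    {μ μ' : Measure H} {a b : ENNReal} (h : HasAffinity μ μ' a) {g g' : H → G}
    (hg : Measurable g) (hg' : Measurable g')
    (hb : ∀ x, b ≤ ∫⁻ y, (w (-g x + y) : ENNReal) * w (-g' x + y) ∂l)
    {e : H × G → H'} {d : H' → H × G} (he : Measurable e) (hd : Measurable d)
    (hde : ∀ x, d (e x) = x) :
    HasAffinity
      ((μ.prod (l.withDensity fun n => (w n : ENNReal) ^ 2)).map fun x => e (x.1, g x.1 + x.2))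
      ((μ'.prod (l.withDensity fun n => (w n : ENNReal) ^ 2)).map fun x => e (x.1, g' x.1 + x.2))
      (a * b) := by
  obtain ⟨m, hm, p, q, hp, hq, rfl, rfl, ha⟩ := h
  have key : ∀ (p : H → ℝ≥0) (g : H → G), Measurable p → Measurable g →
      ((m.withDensity fun h => (p h : ENNReal) ^ 2).prod
        (l.withDensity fun n => (w n : ENNReal) ^ 2)).map (fun x => e (x.1, g x.1 + x.2)) =
      ((m.prod l).map e).withDensity
        (fun z => ((p (d z).1 * w (-g (d z).1 + (d z).2) : ℝ≥0) : ENNReal) ^ 2) := by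
    intro p g hp hg
    refine Measure.ext_of_lintegral _ fun F hF => ?_
    rw [lintegral_map hF (by fun_prop), lintegral_withDensity_eq_lintegral_mul _ (by fun_prop) hF,
      lintegral_map (by fun_prop) he, prod_withDensity (by fun_prop) (by fun_prop),
      lintegral_withDensity_eq_lintegral_mul _ (by fun_prop) (by fun_prop),
      lintegral_prod _ (by fun_prop), lintegral_prod _ (by fun_prop)]
    refine lintegral_congr fun x => ?_
    symm
    rw [← lintegral_add_left_eq_self _ (g x)]
    refine lintegral_congr fun y => ?_
    simp [hde, mul_pow]
  refine ⟨(m.prod l).map e, inferInstance, fun z => p (d z).1 * w (-g (d z).1 + (d z).2),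
    fun z => q (d z).1 * w (-g' (d z).1 + (d z).2), by fun_prop, by fun_prop, key p g hp hg,
    key q g' hq hg', ?_⟩
  rw [lintegral_map (by fun_prop) he, lintegral_prod _ (by fun_prop)]
  calc a * b ≤ (∫⁻ h, (p h : ENNReal) * q h ∂m) * b := by gcongr
    _ = ∫⁻ h, (p h : ENNReal) * q h * b ∂m := by rw [lintegral_mul_const _ (by fun_prop)]
    _ ≤ ∫⁻ h, (p h : ENNReal) * q h *
          ∫⁻ y, (w (-g h + y) : ENNReal) * w (-g' h + y) ∂l ∂m :=
        lintegral_mono fun h => by gcongr; exact hb h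
    _ = _ := by
        refine lintegral_congr fun x => ?_
        rw [← lintegral_const_mul _ (by fun_prop)]
        refine lintegral_congr fun y => ?_
        simp only [hde, ENNReal.coe_mul]
        ring

/-! ### Laws of the history of an algorithm -/

/-- Refreshing one coordinate of an i.i.d. sequence does not change its law. -/
theorem map_update_infinitePi {N : Type*} [MeasurableSpace N] (ν : Measure N)
    [IsProbabilityMeasure ν] (t : ℕ) :
    ((Measure.infinitePi fun _ : ℕ => ν).prod ν).map (fun p => Function.update p.1 t p.2) =
      Measure.infinitePi fun _ : ℕ => ν := by
  refine Measure.eq_infinitePi _ fun s B hB => ?_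
  have hbox : (fun p : (ℕ → N) × N => Function.update p.1 t p.2) ⁻¹' (Set.pi s B) =
      (Set.pi (s.erase t : Finset ℕ) B) ×ˢ (if t ∈ s then B t else univ) := by
    ext ⟨ζ, n⟩
    simp only [mem_preimage, Set.mem_pi, mem_prod, Finset.coe_erase, Finset.mem_coe, mem_sdiff,
      mem_singleton_iff]
    constructor
    · refine fun h => ⟨fun i hi => by simpa [hi.2] using h i hi.1, ?_⟩
      split_ifs with ht
      · simpa using h t ht
      · trivial
    · rintro ⟨h1, h2⟩ i hi
      by_cases hit : i = t
      · subst hit; simpa [hi] using h2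
      · simpa [hit] using h1 i ⟨hi, hit⟩
  rw [Measure.map_apply measurable_update' (.pi s.countable_toSet fun i _ => hB i), hbox,
    Measure.prod_prod, Measure.infinitePi_pi _ fun i _ => hB i]
  split_ifs with ht
  · rw [Finset.prod_erase_mul s (fun i => ν (B i)) ht]
  · rw [Finset.erase_eq_of_notMem ht, measure_univ, mul_one]

namespace Algorithm

variable {Y : Type} [MeasurableSpace Y]

theorem history_update {N : Type} (A : Algorithm.{u} Y) (obs : ℝ → N → Y) (s : A.Seed)
    (ζ : ℕ → N) (n : N) {t k : ℕ} (htk : t ≤ k) :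
    A.history obs s (Function.update ζ k n) t = A.history obs s ζ t := by
  induction t with
  | zero => rfl
  | succ t ih =>
    simp only [history, ih (by omega), Function.update_of_ne (show t ≠ k by omega)]

theorem measurable_snoc (t : ℕ) :
    Measurable fun x : (Fin t → Y) × Y =>
      (Fin.snoc (α := fun _ => Y) x.1 x.2 : Fin (t + 1) → Y) := by
  refine measurable_pi_lambda _ fun i => ?_
  refine Fin.lastCases ?_ (fun j => ?_) i
  · simpa using measurable_snd
  · simp only [Fin.snoc_castSucc]
    fun_prop

/-- The seed and the observations made before stage `t`. -/
def state {N : Type} (A : Algorithm.{u} Y) (obs : ℝ → N → Y) (t : ℕ) (p : A.Seed × (ℕ → N)) :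
    A.Seed × (Fin t → Y) :=
  (p.1, A.history obs p.1 p.2 t)

variable {N : Type} [MeasurableSpace N] (A : Algorithm.{u} Y) {obs : ℝ → N → Y}

theorem measurable_state (hobs : Measurable fun p : Icc (0 : ℝ) 1 × N => obs p.1 p.2) (t : ℕ) :
    Measurable (A.state obs t) := by
  refine measurable_fst.prodMk ?_
  induction t with
  | zero => exact measurable_const
  | succ t ih =>
    refine (measurable_snoc t).comp (ih.prodMk (hobs.comp (Measurable.prodMk ?_ ?_)))
    · exact (A.measurable_alloc t).comp (measurable_fst.prodMk ih)
    · exact (measurable_pi_apply t).comp measurable_snd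

/-- The law of the state before stage `t`. -/
noncomputable def stateLaw (obs : ℝ → N → Y) (ν : Measure N) [IsProbabilityMeasure ν] (t : ℕ) :
    Measure (A.Seed × (Fin t → Y)) :=
  (A.seedLaw.prod (Measure.infinitePi fun _ : ℕ => ν)).map (A.state obs t)

/-- The state forms a Markov chain: stage `t` appends one observation, whose noise is independent of
the state. -/
theorem stateLaw_succ (hobs : Measurable fun p : Icc (0 : ℝ) 1 × N => obs p.1 p.2)
    (ν : Measure N) [IsProbabilityMeasure ν] (t : ℕ) :
    A.stateLaw obs ν (t + 1) = ((A.stateLaw obs ν t).prod ν).map fun x =>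
      (x.1.1, Fin.snoc (α := fun _ => Y) x.1.2 (obs (A.alloc t x.1.1 x.1.2) x.2)) := by
  have hstep : Measurable fun x : (A.Seed × (Fin t → Y)) × N =>
      (x.1.1, (Fin.snoc (α := fun _ => Y) x.1.2 (obs (A.alloc t x.1.1 x.1.2) x.2) :
        Fin (t + 1) → Y)) := by
    refine (measurable_fst.comp measurable_fst).prodMk
      ((measurable_snoc t).comp ((measurable_snd.comp measurable_fst).prodMk
        (hobs.comp (((A.measurable_alloc t).comp measurable_fst).prodMk measurable_snd))))
  have hst := A.measurable_state hobs
  refine Measure.ext_of_lintegral _ fun F hF => ?_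
  have hin : Measurable fun z : A.Seed × (Fin t → Y) => ∫⁻ n, F (z.1,
      (Fin.snoc (α := fun _ => Y) z.2 (obs (A.alloc t z.1 z.2) n) : Fin (t + 1) → Y)) ∂ν :=
    (hF.comp hstep).lintegral_prod_right'
  have hin' : Measurable fun p : A.Seed × (ℕ → N) => ∫⁻ n, F ((A.state obs t p).1,
      (Fin.snoc (α := fun _ => Y) (A.state obs t p).2
        (obs (A.alloc t (A.state obs t p).1 (A.state obs t p).2) n) : Fin (t + 1) → Y)) ∂ν :=
    hin.comp (hst t)
  rw [stateLaw, stateLaw, lintegral_map hF (hst _), lintegral_map hF hstep,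
    lintegral_prod (fun p => F (A.state obs (t + 1) p)) (hF.comp (hst _)).aemeasurable,
    lintegral_prod (fun x : (A.Seed × (Fin t → Y)) × N => F (x.1.1,
      (Fin.snoc (α := fun _ => Y) x.1.2 (obs (A.alloc t x.1.1 x.1.2) x.2) : Fin (t + 1) → Y)))
      (hF.comp hstep).aemeasurable,
    lintegral_map hin (hst t), lintegral_prod _ hin'.aemeasurable]
  refine lintegral_congr fun s => ?_
  have hs : Measurable fun ζ : ℕ → N => F (A.state obs (t + 1) (s, ζ)) :=
    hF.comp ((hst _).comp measurable_prodMk_left)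
  have hs' : Measurable fun p : (ℕ → N) × N =>
      F (A.state obs (t + 1) (s, Function.update p.1 t p.2)) := hs.comp measurable_update'
  conv_lhs => rw [← map_update_infinitePi ν t]
  rw [lintegral_map hs measurable_update', lintegral_prod _ hs'.aemeasurable]
  refine lintegral_congr fun ζ => lintegral_congr fun n => ?_
  simp [state, history, A.history_update obs s ζ n le_rfl]

end Algorithm

/-- If the noise has density `w ^ 2` and two feedbacks `γ x + n` and `γ' x + n` always have affinity
at least `b`, then the two laws of the state before stage `t` have affinity at least `b ^ t`. -/
theorem Algorithm.hasAffinity_stateLaw {G : Type} [MeasurableSpace G] [AddGroup G]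
    [MeasurableAdd₂ G] [MeasurableNeg G] {l : Measure G} [SFinite l] [l.IsAddLeftInvariant]
    {w : G → ℝ≥0} (hw : Measurable w) {ν : Measure G} [IsProbabilityMeasure ν]
    (hν : ν = l.withDensity fun n => (w n : ENNReal) ^ 2) (A : Algorithm.{u} G)
    {obs obs' : ℝ → G → G} {γ γ' : Icc (0 : ℝ) 1 → G} (hγ : Measurable γ) (hγ' : Measurable γ')
    (hobs : ∀ (x : Icc (0 : ℝ) 1) n, obs x n = γ x + n)
    (hobs' : ∀ (x : Icc (0 : ℝ) 1) n, obs' x n = γ' x + n) {b : ENNReal}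
    (hb : ∀ x, b ≤ ∫⁻ y, (w (-γ x + y) : ENNReal) * w (-γ' x + y) ∂l) (t : ℕ) :
    HasAffinity (A.stateLaw obs ν t) (A.stateLaw obs' ν t) (b ^ t) := by
  have hm : Measurable fun p : Icc (0 : ℝ) 1 × G => obs p.1 p.2 := by
    simp only [hobs]; fun_prop
  have hm' : Measurable fun p : Icc (0 : ℝ) 1 × G => obs' p.1 p.2 := by
    simp only [hobs']; fun_prop
  induction t with
  | zero =>
    have : IsProbabilityMeasure (A.stateLaw obs ν 0) :=
      Measure.isProbabilityMeasure_map (A.measurable_state hm 0).aemeasurable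
    rw [pow_zero]
    exact hasAffinity_self (A.stateLaw obs ν 0)
  | succ t ih =>
    rw [A.stateLaw_succ hm, A.stateLaw_succ hm', pow_succ]
    simp only [hobs, hobs']
    subst hν
    have hal := A.measurable_alloc t
    refine ih.observe hw (hγ.comp hal) (hγ'.comp hal) (fun x => hb _)
      (e := fun z => (z.1.1, Fin.snoc (α := fun _ => G) z.1.2 z.2))
      (d := fun z => ((z.1, fun i => z.2 i.castSucc), z.2 (Fin.last t))) ?_ ?_ ?_
    · exact (measurable_fst.comp measurable_fst).prodMk
        ((measurable_snoc t).comp ((measurable_snd.comp measurable_fst).prodMk measurable_snd))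
    · fun_prop
    · rintro ⟨⟨s, h⟩, y⟩
      simp

/-- Whatever threshold `θ` is used at stage `t`, an algorithm cannot tell two feedbacks apart when
the affinity of the states is at least `1 / 2`. -/
theorem Algorithm.le_measure_play {Y N : Type} [MeasurableSpace Y] [MeasurableSpace N]
    (A : Algorithm.{u} Y) {obs obs' : ℝ → N → Y} {ν : Measure N} [IsProbabilityMeasure ν]
    (hobs : Measurable fun p : Icc (0 : ℝ) 1 × N => obs p.1 p.2)
    (hobs' : Measurable fun p : Icc (0 : ℝ) 1 × N => obs' p.1 p.2) {t : ℕ}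
    (h : HasAffinity (A.stateLaw obs ν t) (A.stateLaw obs' ν t) (1 / 2)) (θ : ℝ) :
    1 / 8 ≤ (A.seedLaw.prod (Measure.infinitePi fun _ : ℕ => ν)).real
        {p | A.play obs p.1 p.2 t ≤ θ} +
      (A.seedLaw.prod (Measure.infinitePi fun _ : ℕ => ν)).real
        {p | θ < A.play obs' p.1 p.2 t} := by
  have h1 : IsProbabilityMeasure (A.stateLaw obs ν t) :=
    Measure.isProbabilityMeasure_map (A.measurable_state hobs t).aemeasurable
  have h2 : IsProbabilityMeasure (A.stateLaw obs' ν t) :=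
    Measure.isProbabilityMeasure_map (A.measurable_state hobs' t).aemeasurable
  have hS : MeasurableSet {z : A.Seed × (Fin t → Y) | (A.alloc t z.1 z.2 : ℝ) ≤ θ} :=
    measurableSet_le (measurable_subtype_coe.comp (A.measurable_alloc t)) measurable_const
  have key := h.le_measure_add_measure_compl hS
  rw [stateLaw, stateLaw, map_measureReal_apply (A.measurable_state hobs t) hS,
    map_measureReal_apply (A.measurable_state hobs' t) hS.compl] at key
  convert key using 3
  · rfl
  · exact Set.ext fun p => (not_le (a := A.play obs' p.1 p.2 t) (b := θ)).symm

/-! ### The noise -/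

/-- The square root of the density `15 / 16 * (1 - x ^ 2) ^ 2` on `[-1, 1]` of the noise. It is
Lipschitz on the whole line, which makes the Hellinger distance of the noise law from its
translates linear in the shift. -/
noncomputable def noiseRoot (x : ℝ) : ℝ≥0 :=
  Real.toNNReal (√15 / 4 * max (1 - x ^ 2) 0)

theorem coe_noiseRoot (x : ℝ) : (noiseRoot x : ℝ) = √15 / 4 * max (1 - x ^ 2) 0 :=
  Real.coe_toNNReal _ (by positivity)

theorem continuous_noiseRoot : Continuous noiseRoot := by
  unfold noiseRoot; fun_prop

theorem noiseRoot_sq (x : ℝ) : (noiseRoot x : ℝ) ^ 2 = 15 / 16 * max (1 - x ^ 2) 0 ^ 2 := by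
  rw [coe_noiseRoot, mul_pow, div_pow, Real.sq_sqrt (by norm_num)]; norm_num

theorem noiseRoot_eq_zero {x : ℝ} (hx : x ∉ Icc (-1 : ℝ) 1) : noiseRoot x = 0 := by
  have h : 1 - x ^ 2 ≤ 0 := by
    rw [sub_nonpos, one_le_sq_iff_one_le_abs]
    by_contra! h
    exact hx (abs_le.1 h.le)
  rw [← NNReal.coe_eq_zero, coe_noiseRoot, max_eq_right h, mul_zero]

/-- Integrals against the noise density are integrals of polynomials on `[-1, 1]`. -/
theorem integral_mul_noiseRoot_sq {g : ℝ → ℝ} :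
    ∫ x, g x * (noiseRoot x : ℝ) ^ 2 = ∫ x in (-1 : ℝ)..1, g x * (15 / 16 * (1 - x ^ 2) ^ 2) := by
  rw [intervalIntegral.integral_of_le (by norm_num), ← integral_Icc_eq_integral_Ioc,
    ← setIntegral_eq_integral_of_forall_compl_eq_zero (s := Icc (-1 : ℝ) 1)
      fun x hx => by simp [noiseRoot_eq_zero hx]]
  refine setIntegral_congr_fun measurableSet_Icc fun x hx => ?_
  have : (0 : ℝ) ≤ 1 - x ^ 2 := by nlinarith [hx.1, hx.2]
  simp only [noiseRoot_sq, max_eq_left this]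

theorem lintegral_noiseRoot_sq : ∫⁻ x, (noiseRoot x : ENNReal) ^ 2 = 1 := by
  have hreal : ∫ x, (noiseRoot x : ℝ) ^ 2 = 1 := by
    have := integral_mul_noiseRoot_sq (g := fun _ => 1)
    simp only [one_mul] at this
    have hpoly : ∀ x : ℝ, 15 / 16 * (1 - x ^ 2) ^ 2 = 15 / 16 - 15 / 8 * x ^ 2 + 15 / 16 * x ^ 4 :=
      fun x => by ring
    simp only [this, hpoly]
    rw [intervalIntegral.integral_add (Continuous.intervalIntegrable (by fun_prop) _ _)
      (Continuous.intervalIntegrable (by fun_prop) _ _),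
      intervalIntegral.integral_sub (Continuous.intervalIntegrable (by fun_prop) _ _)
      (Continuous.intervalIntegrable (by fun_prop) _ _)]
    norm_num
  have h := ofReal_integral_eq_lintegral_ofReal (f := fun x => (noiseRoot x : ℝ) ^ 2) (μ := volume)
    (by by_contra h; rw [integral_undef h] at hreal; norm_num at hreal)
    (Filter.Eventually.of_forall fun x => by positivity)
  rw [hreal, ENNReal.ofReal_one] at h
  rw [h]
  refine lintegral_congr fun x => ?_
  rw [ENNReal.ofReal_pow (by positivity), ENNReal.ofReal_coe_nnreal]

/-- The law of the noise. -/
noncomputable def noiseLaw : Measure ℝ :=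
  volume.withDensity fun x => (noiseRoot x : ENNReal) ^ 2

instance : IsProbabilityMeasure noiseLaw :=
  ⟨by rw [noiseLaw, withDensity_apply _ .univ, setLIntegral_univ, lintegral_noiseRoot_sq]⟩

theorem noiseLaw_ae_mem : ∀ᵐ x ∂noiseLaw, x ∈ Icc (-1 : ℝ) 1 := by
  have hm := continuous_noiseRoot.measurable
  rw [noiseLaw, ae_withDensity_iff (by fun_prop)]
  refine Filter.Eventually.of_forall fun x hx => ?_
  by_contra h
  simp [noiseRoot_eq_zero h] at hx

theorem integral_noiseLaw : ∫ x, x ∂noiseLaw = 0 := by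
  have hm := continuous_noiseRoot.measurable
  have h := integral_withDensity_eq_integral_smul (μ := volume) (f := fun x => noiseRoot x ^ 2)
    (by fun_prop) (fun x : ℝ => x)
  have hpoly : ∀ x : ℝ, x * (15 / 16 * (1 - x ^ 2) ^ 2) =
      15 / 16 * x - 15 / 8 * x ^ 3 + 15 / 16 * x ^ 5 := fun x => by ring
  simp only [ENNReal.coe_pow, NNReal.smul_def, NNReal.coe_pow, smul_eq_mul] at h
  rw [noiseLaw, h]
  have h' := integral_mul_noiseRoot_sq (g := fun x => x)
  simp only [hpoly] at h'
  simp only [mul_comm (_ ^ 2) _, h']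
  rw [intervalIntegral.integral_add (Continuous.intervalIntegrable (by fun_prop) _ _)
    (Continuous.intervalIntegrable (by fun_prop) _ _),
    intervalIntegral.integral_sub (Continuous.intervalIntegrable (by fun_prop) _ _)
    (Continuous.intervalIntegrable (by fun_prop) _ _)]
  rw [intervalIntegral.integral_const_mul, integral_id]
  norm_num

theorem noiseRoot_sub_sq_le (x y : ℝ) :
    ((noiseRoot x : ℝ) - noiseRoot y) ^ 2 ≤ 4 * (x - y) ^ 2 := by
  have key : ∀ x y : ℝ, max (1 - x ^ 2) 0 - max (1 - y ^ 2) 0 ≤ 2 * |x - y| := by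
    intro x y
    have h1 := abs_nonneg (x - y)
    have h2 := abs_sub_abs_le_abs_sub y x
    rw [abs_sub_comm y x] at h2
    have hx := abs_nonneg x
    have hy := abs_nonneg y
    rw [← sq_abs x, ← sq_abs y]
    rcases le_total (1 - |x| ^ 2) 0 with hx1 | hx1
    · rw [max_eq_right hx1]
      linarith [le_max_right (1 - |y| ^ 2) 0]
    · have hx2 : |x| ≤ 1 := by nlinarith
      rw [max_eq_left hx1]
      rcases le_total (1 - |y| ^ 2) 0 with hy1 | hy1
      · have hy2 : 1 ≤ |y| := by nlinarith
        rw [max_eq_right hy1]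
        nlinarith
      · have hy2 : |y| ≤ 1 := by nlinarith
        rw [max_eq_left hy1]
        nlinarith
  have h : |max (1 - x ^ 2) 0 - max (1 - y ^ 2) 0| ≤ 2 * |x - y| :=
    abs_sub_le_iff.2 ⟨key x y, by rw [abs_sub_comm]; exact key y x⟩
  rw [coe_noiseRoot, coe_noiseRoot, ← mul_sub, mul_pow, div_pow, Real.sq_sqrt (by norm_num),
    ← sq_abs (max _ _ - _), ← sq_abs (x - y)]
  have := pow_le_pow_left₀ (abs_nonneg _) h 2
  nlinarith [sq_nonneg |max (1 - x ^ 2) 0 - max (1 - y ^ 2) 0|]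

/-- The affinity of two translates of the noise law is quadratically close to `1`. -/
theorem affinity_noiseRoot {a a' : ℝ} (h : |a - a'| ≤ 1) :
    ENNReal.ofReal (1 - 8 * (a - a') ^ 2) ≤
      ∫⁻ y, (noiseRoot (-a + y) : ENNReal) * noiseRoot (-a' + y) := by
  have hm := continuous_noiseRoot.measurable
  obtain ⟨h1, h2⟩ := abs_le.1 h
  -- both translates vanish outside `[a - 2, a + 2]`
  have hpt : ∀ y, (noiseRoot (-a + y) : ENNReal) ^ 2 + (noiseRoot (-a' + y) : ENNReal) ^ 2 ≤
      2 * ((noiseRoot (-a + y) : ENNReal) * noiseRoot (-a' + y)) +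
        (Icc (a - 2) (a + 2)).indicator (fun _ => ENNReal.ofReal (4 * (a - a') ^ 2)) y := by
    intro y
    by_cases hy : y ∈ Icc (a - 2) (a + 2)
    · rw [indicator_of_mem hy]
      rw [← ENNReal.ofReal_coe_nnreal, ← ENNReal.ofReal_coe_nnreal,
        ← ENNReal.ofReal_pow (by positivity), ← ENNReal.ofReal_pow (by positivity),
        ← ENNReal.ofReal_mul (by positivity), ← ENNReal.ofReal_add (by positivity) (by positivity),
        ← ENNReal.ofReal_ofNat 2, ← ENNReal.ofReal_mul (by positivity),
        ← ENNReal.ofReal_add (by positivity) (by positivity)]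
      refine ENNReal.ofReal_le_ofReal ?_
      have := noiseRoot_sub_sq_le (-a + y) (-a' + y)
      nlinarith
    · have e1 : noiseRoot (-a + y) = 0 := noiseRoot_eq_zero fun hm =>
        hy ⟨by linarith [hm.1], by linarith [hm.2]⟩
      have e2 : noiseRoot (-a' + y) = 0 := noiseRoot_eq_zero fun hm =>
        hy ⟨by linarith [hm.1], by linarith [hm.2]⟩
      simp [e1, e2]
  have hint := lintegral_mono (μ := volume) hpt
  rw [lintegral_add_left (by fun_prop), lintegral_add_left (by fun_prop),
    lintegral_const_mul _ (by fun_prop), lintegral_indicator_const measurableSet_Icc,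
    Real.volume_Icc, lintegral_add_left_eq_self (fun y => (noiseRoot y : ENNReal) ^ 2),
    lintegral_add_left_eq_self (fun y => (noiseRoot y : ENNReal) ^ 2), lintegral_noiseRoot_sq,
    ← ENNReal.ofReal_mul (by positivity)] at hint
  by_cases htop : ∫⁻ y, (noiseRoot (-a + y) : ENNReal) * noiseRoot (-a' + y) = ⊤
  · simp [htop]
  rw [ENNReal.ofReal_le_iff_le_toReal htop]
  have := ENNReal.toReal_mono (by finiteness) hint
  rw [ENNReal.toReal_add (by finiteness) (by finiteness),
    ENNReal.toReal_add (by finiteness) (by finiteness), ENNReal.toReal_mul,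
    ENNReal.toReal_ofReal (by nlinarith [sq_nonneg (a - a')])] at this
  norm_num at this
  nlinarith

theorem noiseLaw_prod_noiseLaw : noiseLaw.prod noiseLaw = (volume : Measure (ℝ × ℝ)).withDensity
    fun n => ((noiseRoot n.1 * noiseRoot n.2 : ℝ≥0) : ENNReal) ^ 2 := by
  have hm := continuous_noiseRoot.measurable
  rw [noiseLaw, prod_withDensity (by fun_prop) (by fun_prop)]
  simp only [ENNReal.coe_mul, mul_pow]
  rfl

/-- Translates of the noise law of a pair of observations that differ in the first component
only. -/
theorem affinity_noiseRoot_prod {a a' : ℝ} (b : ℝ) (h : |a - a'| ≤ 1) :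
    ENNReal.ofReal (1 - 8 * (a - a') ^ 2) ≤
      ∫⁻ y : ℝ × ℝ, ((noiseRoot (-(a, b) + y).1 * noiseRoot (-(a, b) + y).2 : ℝ≥0) : ENNReal) *
        ((noiseRoot (-(a', b) + y).1 * noiseRoot (-(a', b) + y).2 : ℝ≥0) : ENNReal) := by
  have hm := continuous_noiseRoot.measurable
  calc _ ≤ (∫⁻ y, (noiseRoot (-a + y) : ENNReal) * noiseRoot (-a' + y)) *
        ∫⁻ y, (noiseRoot (-b + y) : ENNReal) ^ 2 := by
        rw [lintegral_add_left_eq_self (fun y => (noiseRoot y : ENNReal) ^ 2),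
          lintegral_noiseRoot_sq, mul_one]
        exact affinity_noiseRoot h
    _ = _ := by
        rw [← lintegral_prod_mul (by fun_prop) (by fun_prop)]
        refine lintegral_congr fun y => ?_
        simp only [Prod.neg_mk, Prod.fst_add, Prod.snd_add, ENNReal.coe_mul]
        ring

/-! ### The reward functions -/

theorem IsReward.of_hasDerivAt {f f' : ℝ → ℝ} {L L' : ℝ≥0} (hf : ∀ x, HasDerivAt f (f' x) x)
    (hanti : Antitone f') (hf0 : f 0 = 0) (hnonneg : ∀ x ∈ Icc (0 : ℝ) 1, 0 ≤ f' x)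
    (hle : ∀ x ∈ Icc (0 : ℝ) 1, f' x ≤ L)
    (hlip : ∀ x y, |f' x - f' y| ≤ L' * |x - y|) : IsReward L L' f where
  concave := by
    have hd : deriv f = f' := funext fun x => (hf x).deriv
    exact (Antitone.concaveOn_univ_of_deriv (fun x => (hf x).differentiableAt)
      (hd ▸ hanti)).subset (subset_univ _) (convex_Icc 0 1)
  monotone := monotoneOn_of_deriv_nonneg (convex_Icc 0 1)
    (fun x _ => (hf x).continuousAt.continuousWithinAt)
    (fun x _ => (hf x).differentiableAt.differentiableWithinAt)
    (fun x hx => by rw [(hf x).deriv]; exact hnonneg x (interior_subset hx))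
  zero := hf0
  differentiable := fun x _ => (hf x).differentiableAt.differentiableWithinAt
  lipschitz := (convex_Icc (0 : ℝ) 1).lipschitzOnWith_of_nnnorm_deriv_le
    (fun x _ => (hf x).differentiableAt) fun x hx => by
      rw [(hf x).deriv, ← NNReal.coe_le_coe, coe_nnnorm, Real.norm_of_nonneg (hnonneg x hx)]
      exact hle x hx
  smooth := by
    refine LipschitzOnWith.of_dist_le_mul fun x hx y hy => ?_
    have hu := uniqueDiffOn_Icc (zero_lt_one (α := ℝ))
    rw [(hf x).hasDerivWithinAt.derivWithin (hu x hx),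
      (hf y).hasDerivWithinAt.derivWithin (hu y hy)]
    exact hlip x y

theorem isReward_two_mul : IsReward 3 2 (fun x => 2 * x) :=
  .of_hasDerivAt (f' := fun _ => 2) (fun x => by simpa using (hasDerivAt_id x).const_mul 2)
    antitone_const (by simp) (by norm_num) (fun _ _ => by norm_num) (fun x y => by simp)

/-- The concave function with slope `e` at the origin whose curvature is `k` up to the knot `w` and
`k + 1` beyond it. -/
noncomputable def bend (e k w x : ℝ) : ℝ := e * x - k * x ^ 2 / 2 - max (x - w) 0 ^ 2 / 2

/-- The derivative of `bend`. -/
noncomputable def bendSlope (e k w x : ℝ) : ℝ := e - k * x - max (x - w) 0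

/-- The function `max x 0 ^ 2 / 2` lies above its tangents, at most quadratically so. -/
theorem half_sq_max_sub (x y : ℝ) :
    max x 0 * (y - x) ≤ max y 0 ^ 2 / 2 - max x 0 ^ 2 / 2 ∧
      max y 0 ^ 2 / 2 - max x 0 ^ 2 / 2 ≤ max x 0 * (y - x) + (y - x) ^ 2 := by
  rcases le_total x 0 with hx | hx <;> rcases le_total y 0 with hy | hy <;>
    simp only [hx, hy, max_eq_left, max_eq_right] <;> constructor <;>
    nlinarith [sq_nonneg (y - x)]

theorem hasDerivAt_half_sq_max (x : ℝ) :
    HasDerivAt (fun x : ℝ => max x 0 ^ 2 / 2) (max x 0) x := by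
  rw [hasDerivAt_iff_isLittleO]
  refine Asymptotics.IsBigO.trans_isLittleO (g := fun y => ‖y - x‖ ^ 2)
    (.of_bound 1 (Filter.Eventually.of_forall fun y => ?_))
    (Asymptotics.isLittleO_pow_sub_sub x one_lt_two)
  obtain ⟨h1, h2⟩ := half_sq_max_sub x y
  rw [smul_eq_mul, Real.norm_eq_abs, Real.norm_eq_abs, Real.norm_eq_abs, sq_abs, abs_sq, one_mul,
    abs_le]
  constructor <;> nlinarith [sq_nonneg (y - x)]

theorem hasDerivAt_bend (e k w x : ℝ) : HasDerivAt (bend e k w) (bendSlope e k w x) x := by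
  have h1 := (hasDerivAt_id x).const_mul e
  have h2 := ((hasDerivAt_pow 2 x).const_mul k).div_const 2
  have h3 := (hasDerivAt_half_sq_max (x - w)).comp x ((hasDerivAt_id x).sub_const w)
  refine ((h1.sub h2).sub h3).congr_deriv ?_
  simp only [bendSlope]
  push_cast
  ring

theorem continuous_bend (e k w : ℝ) : Continuous (bend e k w) := by
  unfold bend; fun_prop

theorem bend_sub_le {k : ℝ} (hk : 0 ≤ k) (e w x y : ℝ) :
    bend e k w y - bend e k w x ≤ bendSlope e k w x * (y - x) := by
  have := (half_sq_max_sub (x - w) (y - w)).1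
  unfold bend bendSlope
  nlinarith [mul_nonneg hk (sq_nonneg (y - x))]

theorem isReward_bend {e k w : ℝ} (he : 0 ≤ e) (he1 : e ≤ 1) (hk : 0 ≤ k) (hk1 : k ≤ 1)
    (hw : 0 ≤ w) : IsReward 3 2 (fun x => 2 * x + bend e k w x) := by
  have hmax : ∀ x y, max (x - w) 0 - max (y - w) 0 ≤ |x - y| := fun x y => by
    refine sub_le_iff_le_add.2 (max_le ?_ (by positivity))
    linarith [le_abs_self (x - y), le_max_left (y - w) 0]
  refine .of_hasDerivAt (f' := fun x => 2 + bendSlope e k w x)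
    (fun x => ((hasDerivAt_const_mul 2).add (hasDerivAt_bend e k w x)))
    (fun x y hxy => ?_) (by simp [bend, hw]) (fun x hx => ?_) (fun x hx => ?_) (fun x y => ?_)
  · have h1 : max (x - w) 0 ≤ max (y - w) 0 := by gcongr
    have h2 : k * x ≤ k * y := by gcongr
    simp only [bendSlope]
    linarith
  · have h1 : max (x - w) 0 ≤ 1 := max_le (by linarith [hx.2]) zero_le_one
    have h2 : k * x ≤ 1 := mul_le_one₀ hk1 hx.1 hx.2
    simp only [bendSlope]
    linarith
  · have h1 := le_max_right (x - w) 0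
    have h2 : 0 ≤ k * x := mul_nonneg hk hx.1
    simp only [bendSlope, NNReal.coe_ofNat]
    linarith
  · have h1 : |max (x - w) 0 - max (y - w) 0| ≤ |x - y| :=
      abs_sub_le_iff.2 ⟨hmax x y, by rw [abs_sub_comm]; exact hmax y x⟩
    have h2 : |k * (x - y)| ≤ |x - y| := by
      rw [abs_mul, abs_of_nonneg hk]
      exact mul_le_of_le_one_left (abs_nonneg _) hk1
    have h3 : 2 + bendSlope e k w x - (2 + bendSlope e k w y) =
        -(k * (x - y)) - (max (x - w) 0 - max (y - w) 0) := by simp only [bendSlope]; ring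
    rw [h3]
    have h4 := abs_sub (-(k * (x - y))) (max (x - w) 0 - max (y - w) 0)
    rw [abs_neg] at h4
    simp only [NNReal.coe_ofNat]
    linarith

/-- If the slope of `bend` grows at least like the power `1 / (β - 1)` of the distance to its zero
`z₀`, then the Łojasiewicz inequality holds. The maximizer `z₀` need not belong to the
domain `[0, b]`. -/
theorem pairwiseLojasiewicz_bend {e k w z₀ β : ℝ} (hk : 0 ≤ k)
    (hz₀ : bendSlope e k w z₀ = 0)
    (hdist : ∀ x ∈ Icc (0 : ℝ) 1, |z₀ - x| ≤ 2 * |bendSlope e k w x| ^ (β - 1)) :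
    PairwiseLojasiewicz (fun x => 2 * x + bend e k w x) (fun x => 2 * x) β 2 := by
  intro b hb x hx y hy
  rcases hb.1.eq_or_lt with rfl | hb0
  · have hxy : y = x := by linarith [hx.1, hx.2, hy.1, hy.2]
    subst hxy
    rw [sub_self]
    positivity
  have hφ : HasDerivAt (fun z => 2 * z + bend e k w z + 2 * (b - z)) (bendSlope e k w x) x := by
    have h : (fun z => 2 * z + bend e k w z + 2 * (b - z)) = fun z => bend e k w z + 2 * b := by
      ext z; ring
    exact h ▸ (hasDerivAt_bend e k w x).add_const (2 * b)
  rw [hφ.hasDerivWithinAt.derivWithin (uniqueDiffOn_Icc hb0 x hx)]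
  set g := bendSlope e k w x with hg
  have h1 : bend e k w y - bend e k w x ≤ |g| * |z₀ - x| := by
    have ha := bend_sub_le hk e w z₀ y
    have hb := bend_sub_le hk e w x z₀
    rw [hz₀, zero_mul] at ha
    rw [← abs_mul]
    linarith [le_abs_self (g * (z₀ - x))]
  rcases (abs_nonneg g).eq_or_lt with h0 | h0
  · rw [← h0, zero_mul] at h1
    have : (0 : ℝ) ≤ 2 * |g| ^ β := by positivity
    linarith
  · have h2 := mul_le_mul_of_nonneg_left (hdist x ⟨hx.1, hx.2.trans hb.2⟩) h0.le
    have h3 : |g| * |g| ^ (β - 1) = |g| ^ β := by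
      rw [mul_comm, ← Real.rpow_add_one h0.ne', sub_add_cancel]
    rw [← hg, show |g| * (2 * |g| ^ (β - 1)) = 2 * (|g| * |g| ^ (β - 1)) by ring, h3] at h2
    linarith

/-! With `k = δ ^ (2 - β)` and `w = δ ^ (β - 1)`, so that `k * w = δ`, the function `bend δ k w` is
maximal at `w` and `bend 0 k w` at `0`, whereas their slopes differ by `δ` only. -/

theorem curvature_mul_knot {β δ : ℝ} (hδ : δ ∈ Ioc (0 : ℝ) 1) :
    δ ^ (2 - β) * δ ^ (β - 1) = δ := by
  rw [← Real.rpow_add hδ.1]; norm_num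

theorem curvature_mul_knot_sq {β δ : ℝ} (hδ : δ ∈ Ioc (0 : ℝ) 1) :
    δ ^ (2 - β) * (δ ^ (β - 1)) ^ 2 = δ ^ β := by
  rw [sq, ← mul_assoc, curvature_mul_knot hδ]
  nth_rw 1 [← Real.rpow_one δ]
  rw [← Real.rpow_add hδ.1]; ring_nf

theorem curvature_mem {β δ : ℝ} (hβ : β ∈ Icc (1 : ℝ) 2) (hδ : δ ∈ Ioc (0 : ℝ) 1) :
    δ ^ (2 - β) ∈ Ioc (0 : ℝ) 1 :=
  ⟨Real.rpow_pos_of_pos hδ.1 _, Real.rpow_le_one hδ.1.le hδ.2 (by linarith [hβ.2])⟩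

theorem knot_mem {β δ : ℝ} (hβ : β ∈ Icc (1 : ℝ) 2) (hδ : δ ∈ Ioc (0 : ℝ) 1) :
    δ ^ (β - 1) ∈ Ioc (0 : ℝ) 1 :=
  ⟨Real.rpow_pos_of_pos hδ.1 _, Real.rpow_le_one hδ.1.le hδ.2 (by linarith [hβ.1])⟩

/-- Up to the distance `w = δ ^ (β - 1)`, a slope growing at rate `k = δ ^ (2 - β)` controls the
distance: `k d = δ (d / w)`, and `(d / w) ^ (β - 1) ≥ d / w`. -/
theorem le_curvature_mul_rpow {β δ : ℝ} (hβ : β ∈ Icc (1 : ℝ) 2) (hδ : δ ∈ Ioc (0 : ℝ) 1)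
    {d : ℝ} (hd : 0 ≤ d) (hdw : d ≤ δ ^ (β - 1)) :
    d ≤ (δ ^ (2 - β) * d) ^ (β - 1) := by
  have hw := (knot_mem hβ hδ).1
  have h1 : δ ^ (2 - β) * d = δ * (d / δ ^ (β - 1)) := by
    rw [mul_div_assoc', eq_div_iff hw.ne']
    nth_rw 3 [← curvature_mul_knot (β := β) hδ]
    ring
  have h2 := Real.self_le_rpow_of_le_one (x := d / δ ^ (β - 1)) (y := β - 1) (by positivity)
    (div_le_one_of_le₀ hdw hw.le) (by linarith [hβ.2])
  rw [h1, Real.mul_rpow hδ.1.le (by positivity)]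
  calc d = δ ^ (β - 1) * (d / δ ^ (β - 1)) := by field_simp
    _ ≤ _ := by gcongr

theorem le_rpow_of_le {β : ℝ} (hβ : β ∈ Icc (1 : ℝ) 2)
    {x g : ℝ} (hx : 0 ≤ x) (hx1 : x ≤ 1) (hxg : x ≤ g) : x ≤ g ^ (β - 1) :=
  (Real.self_le_rpow_of_le_one hx hx1 (by linarith [hβ.2])).trans
    (Real.rpow_le_rpow hx hxg (by linarith [hβ.1]))

/-- The slope of `bend δ k w` controls the distance to the maximizer `w`. -/
theorem knot_sub_le {β δ : ℝ} (hβ : β ∈ Icc (1 : ℝ) 2) (hδ : δ ∈ Ioc (0 : ℝ) 1)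
    {x : ℝ} (hx : x ∈ Icc (0 : ℝ) 1) :
    |δ ^ (β - 1) - x| ≤ 2 * |bendSlope δ (δ ^ (2 - β)) (δ ^ (β - 1)) x| ^ (β - 1) := by
  have hkw := curvature_mul_knot (β := β) hδ
  have hk := (curvature_mem hβ hδ).1
  have hw := (knot_mem hβ hδ).1
  have hle := fun d => le_curvature_mul_rpow hβ hδ (d := d)
  revert hkw hk hw hle
  generalize δ ^ (2 - β) = k
  generalize δ ^ (β - 1) = w
  intro hkw hk hw hle
  suffices h : |w - x| ≤ |bendSlope δ k w x| ^ (β - 1) by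
    linarith [abs_nonneg (w - x)]
  unfold bendSlope
  rcases le_total x w with h | h
  · rw [max_eq_right (by linarith), abs_of_nonneg (by linarith),
      show δ - k * x - 0 = k * (w - x) by rw [← hkw]; ring, abs_of_nonneg (by nlinarith)]
    exact hle _ (by linarith) (by linarith [hx.1])
  · rw [max_eq_left (by linarith), abs_sub_comm, abs_of_nonneg (by linarith),
      show δ - k * x - (x - w) = -(k * (x - w) + (x - w)) by rw [← hkw]; ring, abs_neg,
      abs_of_nonneg (by nlinarith)]
    exact le_rpow_of_le hβ (by linarith) (by linarith [hx.2]) (by nlinarith)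

/-- The slope of `bend 0 k w` controls the distance to the maximizer `0`. Beyond the knot, the two
parts `w` and `x - w` of the distance are bounded separately, whence the factor `2`. -/
theorem zero_sub_le {β δ : ℝ} (hβ : β ∈ Icc (1 : ℝ) 2) (hδ : δ ∈ Ioc (0 : ℝ) 1)
    {x : ℝ} (hx : x ∈ Icc (0 : ℝ) 1) :
    |0 - x| ≤ 2 * |bendSlope 0 (δ ^ (2 - β)) (δ ^ (β - 1)) x| ^ (β - 1) := by
  have hkw := curvature_mul_knot (β := β) hδ
  have hk := (curvature_mem hβ hδ).1
  have hw := (knot_mem hβ hδ).1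
  have hle := fun d => le_curvature_mul_rpow hβ hδ (d := d)
  have hmono := fun g (hg : δ ≤ g) =>
    Real.rpow_le_rpow hδ.1.le hg (show 0 ≤ β - 1 by linarith [hβ.1])
  revert hkw hk hw hle hmono
  generalize δ ^ (2 - β) = k
  generalize δ ^ (β - 1) = w
  intro hkw hk hw hle hmono
  unfold bendSlope
  have hx0 := hx.1
  rcases le_total x w with h | h
  · rw [max_eq_right (by linarith), abs_sub_comm, sub_zero, abs_of_nonneg hx0,
      show 0 - k * x - 0 = -(k * x) by ring, abs_neg, abs_of_nonneg (by positivity)]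
    have := hle x hx0 h
    linarith
  · have hkx : δ ≤ k * x := by rw [← hkw]; gcongr
    rw [max_eq_left (by linarith), abs_sub_comm, sub_zero, abs_of_nonneg hx0,
      show 0 - k * x - (x - w) = -(k * x + (x - w)) by ring, abs_neg,
      abs_of_nonneg (by linarith [hδ.1])]
    have h1 := hmono (k * x + (x - w)) (by linarith)
    have h2 := le_rpow_of_le hβ (x := x - w) (g := k * x + (x - w)) (by linarith)
      (by linarith [hx.2]) (by linarith [hδ.1])
    linarith

theorem bend_knot_sub_ge {β δ : ℝ} (hβ : β ∈ Icc (1 : ℝ) 2) (hδ : δ ∈ Ioc (0 : ℝ) 1)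
    {x : ℝ} (hxw : x ≤ δ ^ (β - 1) / 2) :
    δ ^ β / 8 ≤ bend δ (δ ^ (2 - β)) (δ ^ (β - 1)) (δ ^ (β - 1)) -
      bend δ (δ ^ (2 - β)) (δ ^ (β - 1)) x := by
  have hkw := curvature_mul_knot (β := β) hδ
  rw [← curvature_mul_knot_sq (β := β) hδ]
  have hk := (curvature_mem hβ hδ).1
  have hw := (knot_mem hβ hδ).1
  revert hkw hk hw hxw
  generalize δ ^ (2 - β) = k
  generalize δ ^ (β - 1) = w
  intro hxw hkw hk hw
  unfold bend
  rw [sub_self, max_self, max_eq_right (by linarith), ← hkw]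
  have : (w / 2) ^ 2 ≤ (w - x) ^ 2 := by gcongr; linarith
  nlinarith

theorem bend_zero_sub_ge {β δ : ℝ} (hβ : β ∈ Icc (1 : ℝ) 2) (hδ : δ ∈ Ioc (0 : ℝ) 1)
    {x : ℝ} (hxw : δ ^ (β - 1) / 2 < x) :
    δ ^ β / 8 ≤ bend 0 (δ ^ (2 - β)) (δ ^ (β - 1)) 0 -
      bend 0 (δ ^ (2 - β)) (δ ^ (β - 1)) x := by
  rw [← curvature_mul_knot_sq (β := β) hδ]
  have hk := (curvature_mem hβ hδ).1
  have hw := (knot_mem hβ hδ).1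
  revert hk hw hxw
  generalize δ ^ (2 - β) = k
  generalize δ ^ (β - 1) = w
  intro hxw hk hw
  unfold bend
  rw [max_eq_right (show 0 - w ≤ 0 by linarith)]
  have : (w / 2) ^ 2 ≤ x ^ 2 := by gcongr
  nlinarith [sq_nonneg (max (x - w) 0)]

/-! ### The regret -/

namespace Algorithm

theorem measurable_play {Y N : Type} [MeasurableSpace Y] [MeasurableSpace N] (A : Algorithm.{u} Y)
    {obs : ℝ → N → Y} (hobs : Measurable fun p : Icc (0 : ℝ) 1 × N => obs p.1 p.2) (t : ℕ) :
    Measurable fun p : A.Seed × (ℕ → N) => A.play obs p.1 p.2 t :=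
  measurable_subtype_coe.comp ((A.measurable_alloc t).comp (A.measurable_state hobs t))

theorem play_mem {Y N : Type} [MeasurableSpace Y] (A : Algorithm.{u} Y) (obs : ℝ → N → Y)
    (s : A.Seed) (ζ : ℕ → N) (t : ℕ) : A.play obs s ζ t ∈ Icc (0 : ℝ) 1 :=
  (A.alloc t s (A.history obs s ζ t)).2

/-- If all the shares in `S` are worse than the share `z` by at least `r`, then the expected regret
is at least `r` times the average probability of playing in `S`. -/
theorem mul_measure_le_expectedRegret {Y N : Type} [MeasurableSpace Y] [MeasurableSpace N]
    (A : Algorithm.{u} Y) {obs : ℝ → N → Y} (ν : Measure N) [IsProbabilityMeasure ν]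
    (hobs : Measurable fun p : Icc (0 : ℝ) 1 × N => obs p.1 p.2) {f₁ f₂ : ℝ → ℝ}
    (hf₁ : Continuous f₁) (hf₂ : Continuous f₂) {S : Set ℝ} (hS : MeasurableSet S) {r z : ℝ}
    (hz : z ∈ Icc (0 : ℝ) 1)
    (hr : ∀ x ∈ S, r ≤ f₁ z + f₂ (1 - z) - (f₁ x + f₂ (1 - x))) {T : ℕ} (hT : 1 ≤ T) :
    (1 / (T : ℝ)) * ∑ t ∈ Finset.range T,
        (A.seedLaw.prod (Measure.infinitePi fun _ : ℕ => ν)).real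
          {p | A.play obs p.1 p.2 t ∈ S} * r ≤
      A.expectedRegret obs ν f₁ f₂ T := by
  have hF : Continuous fun x => f₁ x + f₂ (1 - x) := by fun_prop
  have hplay := A.measurable_play hobs
  have hSt : ∀ t, MeasurableSet {p : A.Seed × (ℕ → N) | A.play obs p.1 p.2 t ∈ S} :=
    fun t => hplay t hS
  obtain ⟨M, hM⟩ := isCompact_Icc.exists_bound_of_continuousOn (s := Icc (0 : ℝ) 1) hF.continuousOn
  have hbdd : BddAbove ((fun x => f₁ x + f₂ (1 - x)) '' Icc 0 1) :=
    (isCompact_Icc.image hF).bddAbove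
  have hint : ∀ t, Integrable (fun p : A.Seed × (ℕ → N) =>
      f₁ (A.play obs p.1 p.2 t) + f₂ (1 - A.play obs p.1 p.2 t))
      (A.seedLaw.prod (Measure.infinitePi fun _ : ℕ => ν)) := fun t =>
    .of_bound (hF.measurable.comp (hplay t)).aestronglyMeasurable M
      (Filter.Eventually.of_forall fun p => hM _ (A.play_mem obs p.1 p.2 t))
  have hind : ∀ t, Integrable ({p : A.Seed × (ℕ → N) | A.play obs p.1 p.2 t ∈ S}.indicator
      fun _ => r) (A.seedLaw.prod (Measure.infinitePi fun _ : ℕ => ν)) := fun t =>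
    (integrable_const r).indicator (hSt t)
  have hlow : ∫ p, (1 / (T : ℝ)) * ∑ t ∈ Finset.range T,
      {p : A.Seed × (ℕ → N) | A.play obs p.1 p.2 t ∈ S}.indicator (fun _ => r) p
      ∂(A.seedLaw.prod (Measure.infinitePi fun _ : ℕ => ν)) ≤ A.expectedRegret obs ν f₁ f₂ T := by
    refine integral_mono ((integrable_finsetSum _ fun t _ => hind t).const_mul _)
      ((integrable_const _).sub ((integrable_finsetSum _ fun t _ => hint t).const_mul _))
      fun p => ?_
    have hT0 : (T : ℝ) ≠ 0 := by positivity
    have hsup : sSup ((fun x => f₁ x + f₂ (1 - x)) '' Icc 0 1) = (1 / (T : ℝ)) *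
        ∑ _t ∈ Finset.range T, sSup ((fun x => f₁ x + f₂ (1 - x)) '' Icc 0 1) := by
      rw [Finset.sum_const, Finset.card_range, nsmul_eq_mul]
      field_simp
    simp only [regret]
    conv_rhs => rw [hsup]
    rw [← mul_sub, ← Finset.sum_sub_distrib]
    gcongr with t
    by_cases hp : A.play obs p.1 p.2 t ∈ S
    · rw [indicator_of_mem (by exact hp)]
      have := le_csSup hbdd (mem_image_of_mem (fun x => f₁ x + f₂ (1 - x)) hz)
      linarith [hr _ hp]
    · rw [indicator_of_notMem (by exact hp), sub_nonneg]
      exact le_csSup hbdd (mem_image_of_mem (fun x => f₁ x + f₂ (1 - x))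
        (A.play_mem obs p.1 p.2 t))
  rw [integral_const_mul, integral_finsetSum _ fun t _ => hind t] at hlow
  simpa only [integral_indicator_const _ (hSt _), smul_eq_mul] using hlow

/-- Two environments with slopes that differ by `δ`, where `16 δ² T ≤ 1`, cannot be told apart in
`T` stages, and a share that is good in one of them costs `δ ^ β / 8` in the other one. -/
theorem le_expectedRegret_add {G : Type} [MeasurableSpace G] [AddGroup G]
    [MeasurableAdd₂ G] [MeasurableNeg G] {l : Measure G} [SFinite l] [l.IsAddLeftInvariant]
    {w : G → ℝ≥0} (hw : Measurable w) {ν : Measure G} [IsProbabilityMeasure ν]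
    (hν : ν = l.withDensity fun n => (w n : ENNReal) ^ 2) (A : Algorithm.{u} G)
    {obs obs' : ℝ → G → G} {γ γ' : Icc (0 : ℝ) 1 → G} (hγ : Measurable γ) (hγ' : Measurable γ')
    (hobs : ∀ (x : Icc (0 : ℝ) 1) n, obs x n = γ x + n)
    (hobs' : ∀ (x : Icc (0 : ℝ) 1) n, obs' x n = γ' x + n) {β δ : ℝ} (hβ : β ∈ Icc (1 : ℝ) 2)
    (hδ : δ ∈ Ioc (0 : ℝ) 1)
    (hb : ∀ x, ENNReal.ofReal (1 - 8 * δ ^ 2) ≤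
      ∫⁻ y, (w (-γ x + y) : ENNReal) * w (-γ' x + y) ∂l)
    {T : ℕ} (hT : 1 ≤ T) (hδT : 16 * δ ^ 2 * T ≤ 1) :
    δ ^ β / 64 ≤
      A.expectedRegret obs ν (fun x => 2 * x + bend δ (δ ^ (2 - β)) (δ ^ (β - 1)) x)
        (fun x => 2 * x) T +
      A.expectedRegret obs' ν (fun x => 2 * x + bend 0 (δ ^ (2 - β)) (δ ^ (β - 1)) x)
        (fun x => 2 * x) T := by
  have hm : Measurable fun p : Icc (0 : ℝ) 1 × G => obs p.1 p.2 := by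
    simp only [hobs]; fun_prop
  have hm' : Measurable fun p : Icc (0 : ℝ) 1 × G => obs' p.1 p.2 := by
    simp only [hobs']; fun_prop
  have hT1 : (1 : ℝ) ≤ T := by exact_mod_cast hT
  have hδ2 : 16 * δ ^ 2 ≤ 1 := by nlinarith [sq_nonneg δ]
  have haff : ∀ t ∈ Finset.range T,
      HasAffinity (A.stateLaw obs ν t) (A.stateLaw obs' ν t) (1 / 2) := by
    intro t ht
    refine (A.hasAffinity_stateLaw hw hν hγ hγ' hobs hobs' hb t).mono ?_
    rw [← ENNReal.ofReal_pow (by linarith)]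
    have h1 := one_add_mul_le_pow (a := -(8 * δ ^ 2)) (by linarith) t
    have h2 : (t : ℝ) ≤ T := by exact_mod_cast (Finset.mem_range.1 ht).le
    have h3 : (1 / 2 : ENNReal) = ENNReal.ofReal (1 / 2) := by
      rw [ENNReal.ofReal_div_of_pos (by norm_num)]; norm_num
    rw [h3]
    refine ENNReal.ofReal_le_ofReal ?_
    rw [← sub_eq_add_neg] at h1
    nlinarith [sq_nonneg δ]
  have hc : ∀ e, Continuous fun x => 2 * x + bend e (δ ^ (2 - β)) (δ ^ (β - 1)) x := fun e =>
    (continuous_const.mul continuous_id).add (continuous_bend _ _ _)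
  have hknot := knot_mem hβ hδ
  have r1 := A.mul_measure_le_expectedRegret ν hm (hc δ) (f₂ := fun x => 2 * x) (by fun_prop)
    (S := Iic (δ ^ (β - 1) / 2)) measurableSet_Iic (r := δ ^ β / 8) ⟨hknot.1.le, hknot.2⟩
    (fun x hx => by linarith [bend_knot_sub_ge hβ hδ hx]) hT
  have r2 := A.mul_measure_le_expectedRegret ν hm' (hc 0) (f₂ := fun x => 2 * x) (by fun_prop)
    (S := Ioi (δ ^ (β - 1) / 2)) measurableSet_Ioi (r := δ ^ β / 8) (z := 0) (by simp)
    (fun x hx => by linarith [bend_zero_sub_ge hβ hδ hx]) hT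
  refine le_trans ?_ (add_le_add r1 r2)
  rw [← mul_add, ← Finset.sum_add_distrib]
  have hpos : 0 ≤ δ ^ β / 8 := div_nonneg (Real.rpow_nonneg hδ.1.le _) (by norm_num)
  calc δ ^ β / 64 = (1 / (T : ℝ)) * ∑ _t ∈ Finset.range T, 1 / 8 * (δ ^ β / 8) := by
        rw [Finset.sum_const, Finset.card_range, nsmul_eq_mul]
        field_simp
        norm_num
    _ ≤ _ := by
        gcongr with t ht
        rw [← add_mul]
        exact mul_le_mul_of_nonneg_right
          (A.le_measure_play hm hm' (haff t ht) (δ ^ (β - 1) / 2)) hpos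

end Algorithm

theorem derivWithin_two_mul_add_bend (e k w : ℝ) {x : ℝ} (hx : x ∈ Icc (0 : ℝ) 1) :
    derivWithin (fun x => 2 * x + bend e k w x) (Icc 0 1) x = 2 + bendSlope e k w x :=
  ((hasDerivAt_const_mul 2).add (hasDerivAt_bend e k w x)).hasDerivWithinAt.derivWithin
    (uniqueDiffOn_Icc zero_lt_one x hx)

theorem derivWithin_two_mul {x : ℝ} (hx : x ∈ Icc (0 : ℝ) 1) :
    derivWithin (fun x : ℝ => 2 * x) (Icc 0 1) x = 2 :=
  (hasDerivAt_const_mul 2).hasDerivWithinAt.derivWithin (uniqueDiffOn_Icc zero_lt_one x hx)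

theorem measurable_bendSlope (e k w : ℝ) : Measurable (bendSlope e k w) := by
  unfold bendSlope; fun_prop

/-- Both environments are admissible, so it suffices to bound the sum of the two regrets, here given
by an arbitrary functional `R` of the rewards. -/
theorem exists_reward_of_le_add {β δ c : ℝ} (hβ : β ∈ Icc (1 : ℝ) 2) (hδ : δ ∈ Ioc (0 : ℝ) 1)
    {R : (ℝ → ℝ) → (ℝ → ℝ) → ℝ}
    (hR : 2 * c ≤ R (fun x => 2 * x + bend δ (δ ^ (2 - β)) (δ ^ (β - 1)) x) (fun x => 2 * x) +
      R (fun x => 2 * x + bend 0 (δ ^ (2 - β)) (δ ^ (β - 1)) x) (fun x => 2 * x)) :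
    ∃ f₁ f₂ : ℝ → ℝ, IsReward 3 2 f₁ ∧ IsReward 3 2 f₂ ∧ PairwiseLojasiewicz f₁ f₂ β 2 ∧
      c ≤ R f₁ f₂ := by
  obtain ⟨hk, hk1⟩ := curvature_mem hβ hδ
  have hw := (knot_mem hβ hδ).1
  by_cases h : c ≤ R (fun x => 2 * x + bend δ (δ ^ (2 - β)) (δ ^ (β - 1)) x) (fun x => 2 * x)
  · refine ⟨_, _, isReward_bend hδ.1.le hδ.2 hk.le hk1 hw.le, isReward_two_mul,
      pairwiseLojasiewicz_bend hk.le ?_ fun x hx => knot_sub_le hβ hδ hx, h⟩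
    simp [bendSlope, curvature_mul_knot hδ]
  · refine ⟨_, _, isReward_bend le_rfl zero_le_one hk.le hk1 hw.le, isReward_two_mul,
      pairwiseLojasiewicz_bend hk.le ?_ fun x hx => zero_sub_le hβ hδ hx, by linarith⟩
    simp [bendSlope, hw.le]

theorem mainTheorem3 :
    ∃ ν : ProbabilityMeasure ℝ,
      (∀ᵐ n ∂(ν : Measure ℝ), n ∈ Icc (-1 : ℝ) 1) ∧ (∫ n, n ∂(ν : Measure ℝ) = 0) ∧
      ∀ β ∈ Icc (1 : ℝ) 2, ∃ c > (0 : ℝ), ∃ C > (0 : ℝ), ∃ L L' : ℝ≥0, ∀ T : ℕ, 1 ≤ T →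
        (∀ A : Algorithm.{u} ℝ, ∃ f₁ f₂ : ℝ → ℝ,
          IsReward L L' f₁ ∧ IsReward L L' f₂ ∧ PairwiseLojasiewicz f₁ f₂ β C ∧
          c * (T : ℝ) ^ (-β / 2) ≤
            A.expectedRegret (slopeFeedback f₁ f₂) (ν : Measure ℝ) f₁ f₂ T) ∧
        (∀ A : Algorithm.{u} (ℝ × ℝ), ∃ f₁ f₂ : ℝ → ℝ,
          IsReward L L' f₁ ∧ IsReward L L' f₂ ∧ PairwiseLojasiewicz f₁ f₂ β C ∧
          c * (T : ℝ) ^ (-β / 2) ≤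
            A.expectedRegret (gradientFeedback f₁ f₂)
              ((ν : Measure ℝ).prod (ν : Measure ℝ)) f₁ f₂ T) := by
  have hw := continuous_noiseRoot.measurable
  refine ⟨⟨noiseLaw, inferInstance⟩, noiseLaw_ae_mem, integral_noiseLaw, fun β hβ =>
    ⟨(1 / 4) ^ β / 128, by positivity, 2, by norm_num, 3, 2, fun T hT => ?_⟩⟩
  have hT1 : (1 : ℝ) ≤ T := by exact_mod_cast hT
  -- the largest `δ` with `16 δ² T ≤ 1`
  obtain ⟨δ, hδT⟩ : ∃ δ : ℝ, δ = 1 / 4 * (T : ℝ) ^ (-(1 / 2) : ℝ) := ⟨_, rfl⟩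
  have hpow : (T : ℝ) ^ (-(1 / 2) : ℝ) ≤ 1 := Real.rpow_le_one_of_one_le_of_nonpos hT1 (by norm_num)
  have hpow0 : 0 < (T : ℝ) ^ (-(1 / 2) : ℝ) := by positivity
  have hδ : δ ∈ Ioc (0 : ℝ) 1 := ⟨by rw [hδT]; positivity, by linarith⟩
  have hδ2 : 16 * δ ^ 2 * T ≤ 1 := by
    have : ((T : ℝ) ^ (-(1 / 2) : ℝ)) ^ 2 * T = 1 := by
      rw [← Real.rpow_natCast, ← Real.rpow_mul (by positivity), ← Real.rpow_add_one (by positivity)]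
      norm_num
    rw [hδT]
    nlinarith
  have hδβ : (1 / 4) ^ β / 128 * (T : ℝ) ^ (-β / 2) = δ ^ β / 128 := by
    rw [hδT, Real.mul_rpow (by norm_num) (by positivity), ← Real.rpow_mul (by positivity)]
    ring_nf
  rw [hδβ]
  have hslope : ∀ e e' k w x : ℝ, bendSlope e k w x - bendSlope e' k w x = e - e' :=
    fun e e' k w x => by simp only [bendSlope]; ring
  have hδabs : |δ - 0| ≤ 1 := by rw [sub_zero, abs_of_pos hδ.1]; exact hδ.2
  have h1x : ∀ x : Icc (0 : ℝ) 1, 1 - (x : ℝ) ∈ Icc (0 : ℝ) 1 := fun x =>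
    ⟨by linarith [x.2.2], by linarith [x.2.1]⟩
  have hbm := fun e => (measurable_bendSlope e (δ ^ (2 - β)) (δ ^ (β - 1))).comp
    (measurable_subtype_coe (p := fun x : ℝ => x ∈ Icc (0 : ℝ) 1))
  constructor
  · intro A
    refine exists_reward_of_le_add hβ hδ
      (R := fun f₁ f₂ => A.expectedRegret (slopeFeedback f₁ f₂) noiseLaw f₁ f₂ T) ?_
    refine le_trans (by linarith) (A.le_expectedRegret_add (ν := noiseLaw) hw rfl (hbm δ) (hbm 0)
      ?_ ?_ hβ hδ ?_ hT hδ2)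
    · intro x n
      simp [slopeFeedback, derivWithin_two_mul_add_bend _ _ _ x.2, derivWithin_two_mul (h1x x)]
    · intro x n
      simp [slopeFeedback, derivWithin_two_mul_add_bend _ _ _ x.2, derivWithin_two_mul (h1x x)]
    · intro x
      have h := affinity_noiseRoot (a := bendSlope δ (δ ^ (2 - β)) (δ ^ (β - 1)) x)
        (a' := bendSlope 0 (δ ^ (2 - β)) (δ ^ (β - 1)) x) (by rw [hslope]; exact hδabs)
      rw [hslope, sub_zero] at h
      exact h
  · intro A
    refine exists_reward_of_le_add hβ hδ (R := fun f₁ f₂ =>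
      A.expectedRegret (gradientFeedback f₁ f₂) (noiseLaw.prod noiseLaw) f₁ f₂ T) ?_
    refine le_trans (by linarith) (A.le_expectedRegret_add (by fun_prop) noiseLaw_prod_noiseLaw
      (γ := fun x => (2 + bendSlope δ (δ ^ (2 - β)) (δ ^ (β - 1)) x, 2))
      (γ' := fun x => (2 + bendSlope 0 (δ ^ (2 - β)) (δ ^ (β - 1)) x, 2))
      (((hbm δ).const_add 2).prodMk measurable_const)
      (((hbm 0).const_add 2).prodMk measurable_const) ?_ ?_ hβ hδ ?_ hT hδ2)
    · intro x n
      simp [gradientFeedback, derivWithin_two_mul_add_bend _ _ _ x.2, derivWithin_two_mul (h1x x),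
        Prod.ext_iff]
    · intro x n
      simp [gradientFeedback, derivWithin_two_mul_add_bend _ _ _ x.2, derivWithin_two_mul (h1x x),
        Prod.ext_iff]
    · intro x
      have h := affinity_noiseRoot_prod (a := 2 + bendSlope δ (δ ^ (2 - β)) (δ ^ (β - 1)) x)
        (a' := 2 + bendSlope 0 (δ ^ (2 - β)) (δ ^ (β - 1)) x) 2
        (by rw [add_sub_add_left_eq_sub, hslope]; exact hδabs)
      rw [add_sub_add_left_eq_sub, hslope, sub_zero] at h
      exact h
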